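/- Let $F$ be a field with $\operatorname{char} F \neq 2$. A family is a sequence $(f_n)_{n\in\mathbb N}$ of polynomials over $F$ in variables $x_0,x_1,x_2,\dots$; it is over polynomially many variables if the number of variables occurring in $f_n$ is polynomially bounded in $n$. An affine linear form is a polynomial $\sum_i \alpha_i x_i+\beta$. An algebraic branching program (ABP) over $F$ is a finite directed graph with a source vertex and a sink vertex, in which each vertex has an integer layer, each edge goes from a layer $i$ to layer $i+1$, and each edge is labeled by an affine linear form over $F$. Its size is its number of vertices, its width is the cardinality of its largest layer, and it computes the sum, over all paths from the source to the sink, of the product of the edge labels on the path. Let $\mathrm{VP}_1$ be the class of families over polynomially many variables that are computed by width-$1$ ABPs of polynomially bounded size. Let $\mathrm{VP}$ be the class of families over polynomially many variables, of polynomially bounded degree, that are computed by arithmetic circuits (with constants from $F$ and fan-in $2$ addition and multiplication gates) of polynomially bounded size. For a class $\mathcal C$ of families let $\mathbf N(\mathcal C)$ be the class of all families $(f_n)$ for which there are $(g_n)\in\mathcal C$ and polynomially bounded functions $p,q:\mathbb N\to\mathbb N$ such that, for all $n$, $$f_n(x)=\sum_{b\in\{0,1\}^{p(n)}} g_{q(n)}(b,x),$$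 where $g_{q(n)}(b,x)$ is obtained by substituting $b$ for the first $p(n)$ variables and $x_0,x_1,\dots$ for the following ones. Put $\mathrm{VNP}=\mathbf N(\mathrm{VP})$ and $\mathrm{VNP}_1=\mathbf N(\mathrm{VP}_1)$. Then $\mathrm{VNP}_1=\mathrm{VNP}$. Moreover, a family $(f_n)$ is in $\mathrm{VNP}$ if and only if it is over polynomially many variables and there are polynomially bounded functions $p,m:\mathbb N\to\mathbb N$ and affine linear forms $\ell_{n,1},\dots,\ell_{n,m(n)}$ such that, for all $n$, $$f_n(x)=\sum_{b\in\{0,1\}^{p(n)}}\ \prod_{i=1}^{m(n)}\ell_{n,i}(b,x).$$ -/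

import Mathlib

namespace AlgComplexity

open MvPolynomial

/-- `p ∈ poly(n)`: the function `p : ℕ → ℕ` is polynomially bounded. -/
def PolyBounded (p : ℕ → ℕ) : Prop :=
  ∃ P : Polynomial ℕ, ∀ n, p n ≤ P.eval n

/-- A family `(f_n)` of polynomials over `F`. The variables `x_0, x_1, x_2, …` are indexed by `ℕ`;
each `f_n` uses finitely many of them. -/
abbrev Family (F : Type*) [Field F] := ℕ → MvPolynomial ℕ F

/-- The family is over polynomially many variables: the number of variables that occur in `f_n`
is a polynomially bounded function of `n`. -/
def HasPolyManyVars {F : Type*} [Field F] (f : Family F) : Prop :=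
  PolyBounded fun n => (f n).vars.card

/-- Affine linear forms `∑ α_i x_i + β`, that is, polynomials of degree at most one. -/
def IsAffineForm {F : Type*} [Field F] (l : MvPolynomial ℕ F) : Prop :=
  l.totalDegree ≤ 1

/-! ### Arithmetic circuits, `VP` -/

/-- `r_0, …, r_{s-1}` are the polynomials computed at the `s` gates, listed in topological order,
of an arithmetic circuit over `F`: every gate is an input gate carrying a constant or a variable,
or an addition or a multiplication gate applied to two (possibly equal) earlier gates. -/
def IsCircuit {F : Type*} [Field F] {s : ℕ} (r : Fin s → MvPolynomial ℕ F) : Prop :=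
  ∀ i : Fin s,
    (∃ a : F, r i = C a) ∨
    (∃ x : ℕ, r i = X x) ∨
    (∃ j < i, ∃ k < i, r i = r j + r k) ∨
    (∃ j < i, ∃ k < i, r i = r j * r k)

/-- Some arithmetic circuit with exactly `s` gates (inputs included) computes `f` at one of its
gates. -/
def ComputedByCircuit {F : Type*} [Field F] (f : MvPolynomial ℕ F) (s : ℕ) : Prop :=
  ∃ r : Fin s → MvPolynomial ℕ F, IsCircuit r ∧ ∃ i, r i = f

/-- The class `VP`: families over polynomially many variables, of polynomially bounded degree,
that are computed by arithmetic circuits of polynomially bounded size. -/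
def VP (F : Type*) [Field F] : Set (Family F) :=
  {f | HasPolyManyVars f ∧ (PolyBounded fun n => (f n).totalDegree) ∧
    ∃ s : ℕ → ℕ, PolyBounded s ∧ ∀ n, ComputedByCircuit (f n) (s n)}

/-! ### Algebraic branching programs, `VP_k` -/

/-- An algebraic branching program over `F`: a directed graph on finitely many vertices with a
source and a sink, in which every vertex has a layer, every edge goes from some layer `i` to layer
`i + 1` (so the graph is acyclic), and every edge is labeled by an affine linear form. The value of
`label u v` is irrelevant when there is no edge from `u` to `v`. -/
structure ABP (F : Type*) [Field F] where
  /-- the number of vertices -/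
  size : ℕ
  /-- the layer of a vertex -/
  layer : Fin size → ℤ
  /-- `Edge u v`: there is an edge from `u` to `v` -/
  Edge : Fin size → Fin size → Prop
  /-- the edge labels -/
  label : Fin size → Fin size → MvPolynomial ℕ F
  source : Fin size
  sink : Fin size
  layer_edge : ∀ u v, Edge u v → layer v = layer u + 1
  affine_label : ∀ u v, Edge u v → IsAffineForm (label u v)

namespace ABP

variable {F : Type*} [Field F]

/-- The width: the cardinality of the largest layer. -/
def width (Γ : ABP F) : ℕ :=
  Finset.univ.sup fun v : Fin Γ.size =>
    (Finset.univ.filter fun u : Fin Γ.size => Γ.layer u = Γ.layer v).card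

/-- The number of edges that every path from the source to the sink has, if there is a path. -/
def pathLength (Γ : ABP F) : ℕ := (Γ.layer Γ.sink - Γ.layer Γ.source).toNat

/-- `γ_0, …, γ_L` is a directed path from the source to the sink. As each edge raises the layer by
one, every such path has exactly `L = Γ.pathLength` edges. -/
def IsPath (Γ : ABP F) (γ : Fin (Γ.pathLength + 1) → Fin Γ.size) : Prop :=
  γ 0 = Γ.source ∧ γ (Fin.last _) = Γ.sink ∧
    ∀ i : Fin Γ.pathLength, Γ.Edge (γ i.castSucc) (γ i.succ)

open Classical in
/-- The value (the polynomial that is computed): the sum, over all paths from the source to the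
sink, of the product of the edge labels on the path. -/
noncomputable def value (Γ : ABP F) : MvPolynomial ℕ F :=
  ∑ γ ∈ Finset.univ.filter (fun γ => Γ.IsPath γ),
    ∏ i : Fin Γ.pathLength, Γ.label (γ i.castSucc) (γ i.succ)

end ABP

/-- The class `VP_k`: families over polynomially many variables that are computed by width-`k`
algebraic branching programs of polynomially bounded size. -/
def VPk (F : Type*) [Field F] (k : ℕ) : Set (Family F) :=
  {f | HasPolyManyVars f ∧
    ∃ Γ : ℕ → ABP F, (PolyBounded fun n => (Γ n).size) ∧
      ∀ n, (Γ n).width = k ∧ (Γ n).value = f n}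

/-! ### Nondeterminism closure -/

/-- The substitution that sends the first `p` variables to the bits `b_0, …, b_{p-1} ∈ {0,1}` and
the following variables to `x_0, x_1, …`. -/
noncomputable def cubeSubst {F : Type*} [Field F] {p : ℕ} (b : Fin p → Bool) (i : ℕ) :
    MvPolynomial ℕ F :=
  if h : i < p then (if b ⟨i, h⟩ then 1 else 0) else X (i - p)

/-- The hypercube sum `∑_{b ∈ {0,1}^p} g(b, x)` of dimension `p` over `g`. -/
noncomputable def hypercubeSum {F : Type*} [Field F] (p : ℕ) (g : MvPolynomial ℕ F) :
    MvPolynomial ℕ F :=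
  ∑ b : Fin p → Bool, bind₁ (cubeSubst b) g

/-- The nondeterminism closure `N(𝒞)`: the families with
`f_n(x) = ∑_{b ∈ {0,1}^{p(n)}} g_{q(n)}(b, x)` for some `(g_n) ∈ 𝒞` and polynomially bounded
`p`, `q`. -/
def NClosure {F : Type*} [Field F] (𝒞 : Set (Family F)) : Set (Family F) :=
  {f | ∃ g ∈ 𝒞, ∃ p q : ℕ → ℕ, PolyBounded p ∧ PolyBounded q ∧
    ∀ n, f n = hypercubeSum (p n) (g (q n))}

/-- `VNP = N(VP)`, the class of p-definable families. -/
def VNP (F : Type*) [Field F] : Set (Family F) := NClosure (VP F)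

/-- `VNP_k = N(VP_k)`. -/
def VNPk (F : Type*) [Field F] (k : ℕ) : Set (Family F) := NClosure (VPk F k)

end AlgComplexity

/-!
In both claims the substance is that a hypercube sum over a polynomial `g` with a small circuit and
small degree is also a hypercube sum over a short product of affine linear forms.

Call a polynomial that depends on bits *cheap* if it is a hypercube sum of a product of affine
forms, with few summation bits and few factors (`CubeRep`). Products of cheap functions are cheap,
and so are their sums over bits. Since the characteristic is not two, conditional evaluation is
cheap as well (`CubeRep.ite_one`): for a bit `c`, the identity
`∑_{d ∈ {0,1}} (l/2 - d) (1 - 2d + c) = if c then l else 1` switches a single affine factor on or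
off. Hence equality of bits can be tested, and `∑_r w_r(b) φ(θ_r(b))` costs only a polynomial amount
more than *one* copy of `φ`: sum over a one-hot vector that selects `r` and over the bits of
`θ_r(b)`, and check the choice (`CubeRep.sum_mul_comp`). Iterating such a step `t` times multiplies
the additional cost by `t`, which makes computations with a bounded memory cheap.

A circuit fits this pattern after homogenization. The homogeneous components of degrees `1, …, d`
at its gates satisfy a system of quadratic equations
`f_w = leaf_w + ∑_{u, v} c_{w, u, v} f_u f_v` in which degrees add up
(`IsCircuit.exists_quadraticSystem`). Read as a weighted grammar, this says that `f_w` is the total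
weight of the leftmost derivations from `w`. All of these have exactly `2 deg w - 1` steps, and
their stacks hold at most `deg w` symbols (`QuadraticSystem.derivations_stack`). So `f_w` is cheap,
and with it every hypercube sum over the polynomial computed by the circuit.

Conversely, a product of affine forms is the value of a branching program that is a single path,
and every nonzero value of a branching program of width one is such a product
(`ABP.exists_value_eq_prod`). A nonzero product contains every variable of its factors, so a bound
on the number of its variables bounds the size of a circuit for it (`VPk_one_subset_VP`).
-/

namespace AlgComplexity

open MvPolynomial

variable {F : Type*} [Field F]

/-! ### Hypercube sums of products of affine forms that depend on bits -/

section CubeRep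

variable {A B K : Type} [Fintype A] [Fintype B] [DecidableEq B] [Fintype K]

/-- A bit, read as the constant polynomial `0` or `1`. -/
noncomputable def bit (c : Bool) : MvPolynomial ℕ F := if c then 1 else 0

@[simp] theorem bit_true : bit (F := F) true = 1 := rfl
@[simp] theorem bit_false : bit (F := F) false = 0 := rfl

/-- Affine linear forms in the variables `x_i` and in bits indexed by `A`, as functions of the
bits: an affine form in the `x_i` plus a linear combination of the bits with coefficients in `F`. -/
def IsBitAffine (ψ : (A → Bool) → MvPolynomial ℕ F) : Prop :=
  ∃ (l : MvPolynomial ℕ F) (c : A → F), IsAffineForm l ∧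
    ∀ b, ψ b = l + ∑ a, C (c a) * bit (b a)

namespace IsBitAffine

theorem of_isAffineForm {l : MvPolynomial ℕ F} (hl : IsAffineForm l) :
    IsBitAffine (fun _ : A → Bool => l) :=
  ⟨l, 0, hl, by simp⟩

theorem const (a : F) : IsBitAffine (fun _ : A → Bool => (C a : MvPolynomial ℕ F)) :=
  of_isAffineForm (by simp [IsAffineForm])

theorem one : IsBitAffine (fun _ : A → Bool => (1 : MvPolynomial ℕ F)) := by
  simpa using const (F := F) (A := A) 1

theorem apply (a : A) : IsBitAffine (fun b : A → Bool => bit (F := F) (b a)) := by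
  classical
  refine ⟨0, Pi.single a 1, by simp [IsAffineForm], fun b => ?_⟩
  rw [Finset.sum_eq_single a] <;> simp +contextual

theorem bit_const (c : Bool) : IsBitAffine (fun _ : A → Bool => bit (F := F) c) := by
  cases c
  · simpa using const (F := F) (A := A) 0
  · simpa using const (F := F) (A := A) 1

theorem add {ψ χ : (A → Bool) → MvPolynomial ℕ F} (hψ : IsBitAffine ψ) (hχ : IsBitAffine χ) :
    IsBitAffine (fun b => ψ b + χ b) := by
  obtain ⟨l, c, hl, h⟩ := hψ
  obtain ⟨l', c', hl', h'⟩ := hχ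
  refine ⟨l + l', c + c', (totalDegree_add _ _).trans (max_le hl hl'), fun b => ?_⟩
  simp only [h, h', Pi.add_apply, C_add, add_mul, Finset.sum_add_distrib]
  ring

theorem const_mul {ψ : (A → Bool) → MvPolynomial ℕ F} (a : F) (hψ : IsBitAffine ψ) :
    IsBitAffine (fun b => C a * ψ b) := by
  obtain ⟨l, c, hl, h⟩ := hψ
  refine ⟨C a * l, fun i => a * c i, ?_, fun b => ?_⟩
  · exact (totalDegree_mul _ _).trans (by simpa [IsAffineForm] using hl)
  · simp only [h, C_mul, mul_add, Finset.mul_sum, mul_assoc]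

theorem sub {ψ χ : (A → Bool) → MvPolynomial ℕ F} (hψ : IsBitAffine ψ) (hχ : IsBitAffine χ) :
    IsBitAffine (fun b => ψ b - χ b) := by
  have := hψ.add (hχ.const_mul (-1))
  simpa [sub_eq_add_neg] using this

theorem sum {ι : Type*} (s : Finset ι) {ψ : ι → (A → Bool) → MvPolynomial ℕ F}
    (h : ∀ i ∈ s, IsBitAffine (ψ i)) : IsBitAffine (fun b => ∑ i ∈ s, ψ i b) := by
  classical
  induction s using Finset.induction_on with
  | empty => simpa using const (F := F) (A := A) 0
  | insert i s hi ih =>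
    simp only [Finset.sum_insert hi]
    exact (h i (by simp)).add (ih fun j hj => h j (by simp [hj]))

theorem bit_not {β : (A → Bool) → Bool} (hβ : IsBitAffine fun b => bit (F := F) (β b)) :
    IsBitAffine fun b => bit (F := F) (!β b) := by
  convert one.sub hβ using 2 with b
  cases β b <;> simp

theorem comp {ψ : (K → Bool) → MvPolynomial ℕ F} (hψ : IsBitAffine ψ)
    {θ : (A → Bool) → K → Bool} (hθ : ∀ k, IsBitAffine fun b => bit (F := F) (θ b k)) :
    IsBitAffine (fun b => ψ (θ b)) := by
  obtain ⟨l, c, hl, h⟩ := hψ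
  simp only [h]
  exact (of_isAffineForm hl).add (sum _ fun k _ => (hθ k).const_mul _)

end IsBitAffine

/-- `CubeRep φ c`: as a function of the bits indexed by `A`, the polynomial `φ b` is a hypercube
sum of a product of affine forms in the bits, the summation bits and the variables `x_i`, where
the number of summation bits and the number of factors add up to at most `c`. -/
def CubeRep (φ : (A → Bool) → MvPolynomial ℕ F) (c : ℕ) : Prop :=
  ∃ (B I : Type) (_ : Fintype B) (_ : DecidableEq B) (_ : Fintype I) (_ : DecidableEq I)
    (ψ : I → (A ⊕ B → Bool) → MvPolynomial ℕ F),
    (∀ i, IsBitAffine (ψ i)) ∧ Fintype.card B + Fintype.card I ≤ c ∧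
    ∀ b, φ b = ∑ b' : B → Bool, ∏ i, ψ i (Sum.elim b b')

theorem sum_sum_elim {M : Type*} [AddCommMonoid M] {B B' : Type} [Fintype B] [DecidableEq B]
    [Fintype B'] [DecidableEq B'] (f : (B ⊕ B' → Bool) → M) :
    ∑ b, f b = ∑ b : B → Bool, ∑ b' : B' → Bool, f (Sum.elim b b') := by
  rw [← Fintype.sum_prod_type']
  exact Fintype.sum_equiv (Equiv.sumArrowEquivProdArrow B B' Bool) _ _ fun b => by
    simp [Equiv.sumArrowEquivProdArrow]

namespace CubeRep

theorem mono {φ : (A → Bool) → MvPolynomial ℕ F} {c c' : ℕ} (h : CubeRep φ c) (hc : c ≤ c') :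
    CubeRep φ c' := by
  obtain ⟨B, I, _, _, _, _, ψ, hψ, hcard, h⟩ := h
  exact ⟨B, I, _, inferInstance, _, inferInstance, ψ, hψ, hcard.trans hc, h⟩

theorem one : CubeRep (fun _ : A → Bool => (1 : MvPolynomial ℕ F)) 0 :=
  ⟨Empty, Empty, inferInstance, inferInstance, inferInstance, inferInstance, fun i => i.elim,
    fun i => i.elim, by simp, by simp⟩

theorem of_isBitAffine {φ : (A → Bool) → MvPolynomial ℕ F} (h : IsBitAffine φ) :
    CubeRep φ 1 := by
  refine ⟨Empty, Unit, inferInstance, inferInstance, inferInstance, inferInstance,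
    fun _ b => φ (b ∘ Sum.inl), fun _ => h.comp fun k => IsBitAffine.apply _, by simp, by simp⟩

theorem mul {φ φ' : (A → Bool) → MvPolynomial ℕ F} {c c' : ℕ} (h : CubeRep φ c)
    (h' : CubeRep φ' c') : CubeRep (fun b => φ b * φ' b) (c + c') := by
  obtain ⟨B, I, _, _, _, _, ψ, hψ, hc, h⟩ := h
  obtain ⟨B', I', _, _, _, _, ψ', hψ', hc', h'⟩ := h'
  refine ⟨B ⊕ B', I ⊕ I', inferInstance, inferInstance, inferInstance, inferInstance,
    Sum.elim (fun i b => ψ i (b ∘ Sum.map id Sum.inl)) (fun i b => ψ' i (b ∘ Sum.map id Sum.inr)),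
    ?_, ?_, fun b => ?_⟩
  · rintro (i | i)
    · exact (hψ i).comp fun k => IsBitAffine.apply _
    · exact (hψ' i).comp fun k => IsBitAffine.apply _
  · simp only [Fintype.card_sum]; omega
  · have e1 (x : B → Bool) (y : B' → Bool) :
        Sum.elim b (Sum.elim x y) ∘ Sum.map id Sum.inl = Sum.elim b x := by
      ext (_ | _) <;> rfl
    have e2 (x : B → Bool) (y : B' → Bool) :
        Sum.elim b (Sum.elim x y) ∘ Sum.map id Sum.inr = Sum.elim b y := by
      ext (_ | _) <;> rfl
    simp only [sum_sum_elim, Fintype.prod_sum_type, Sum.elim_inl, Sum.elim_inr, e1, e2, h, h',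
      Finset.sum_mul_sum]

theorem prod {ι : Type*} (s : Finset ι) {φ : ι → (A → Bool) → MvPolynomial ℕ F} {c : ℕ}
    (h : ∀ i ∈ s, CubeRep (φ i) c) : CubeRep (fun b => ∏ i ∈ s, φ i b) (s.card * c) := by
  classical
  induction s using Finset.induction_on with
  | empty => simpa using one
  | insert i s hi ih =>
    simp only [Finset.prod_insert hi, Finset.card_insert_of_notMem hi]
    refine ((h i (by simp)).mul (ih fun j hj => h j (by simp [hj]))).mono ?_
    rw [Nat.succ_mul, add_comm]

/-- Summing over some of the bits. -/
theorem sum_bits {φ : (A ⊕ B → Bool) → MvPolynomial ℕ F} {c : ℕ} (h : CubeRep φ c) :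
    CubeRep (fun b => ∑ b' : B → Bool, φ (Sum.elim b b')) (Fintype.card B + c) := by
  obtain ⟨B', I, _, _, _, _, ψ, hψ, hc, h⟩ := h
  refine ⟨B ⊕ B', I, inferInstance, inferInstance, inferInstance, inferInstance,
    fun i b => ψ i (b ∘ Equiv.sumAssoc A B B'), fun i => (hψ i).comp fun k => IsBitAffine.apply _,
    ?_, fun b => ?_⟩
  · simp only [Fintype.card_sum]; omega
  · have e (x : B → Bool) (y : B' → Bool) :
        Sum.elim b (Sum.elim x y) ∘ Equiv.sumAssoc A B B' = Sum.elim (Sum.elim b x) y := by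
      ext ((_ | _) | _) <;> rfl
    simp only [sum_sum_elim, e, h]

theorem comp {φ : (K → Bool) → MvPolynomial ℕ F} {c : ℕ} (h : CubeRep φ c)
    {θ : (A → Bool) → K → Bool} (hθ : ∀ k, IsBitAffine fun b => bit (F := F) (θ b k)) :
    CubeRep (fun b => φ (θ b)) c := by
  obtain ⟨B, I, _, _, _, _, ψ, hψ, hc, h⟩ := h
  refine ⟨B, I, inferInstance, inferInstance, inferInstance, inferInstance,
    fun i b => ψ i (Sum.elim (θ (b ∘ Sum.inl)) (b ∘ Sum.inr)), fun i => (hψ i).comp ?_, hc,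
    fun b => ?_⟩
  · rintro (k | k)
    · exact (hθ k).comp fun a => IsBitAffine.apply _
    · exact IsBitAffine.apply _
  · simp only [h, Sum.elim_comp_inl, Sum.elim_comp_inr]

/-- For a bit `c` and an affine form `l`, the polynomial "`l` if `c`, else `1`" is
`∑_{d ∈ {0,1}} (l/2 - d) (1 - 2d + c)`. This is where the characteristic must not be two. -/
theorem sum_ite_gadget (h2 : (2 : F) ≠ 0) (c : Bool) (l : MvPolynomial ℕ F) :
    ∑ d : Bool, (C (1 / 2) * l - bit d) * (1 - C 2 * bit d + bit c) = if c then l else 1 := by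
  have h : (C (1 / 2) * C 2 : MvPolynomial ℕ F) = 1 := by
    rw [← C_mul, one_div, inv_mul_cancel₀ h2, C_1]
  have h' : (C 2 : MvPolynomial ℕ F) = 2 := map_ofNat C 2
  cases c
  · simp [h']
    ring
  · simp only [Fintype.sum_bool, bit_true, bit_false, if_true]
    rw [h'] at h ⊢
    linear_combination l * h

/-- Conditional evaluation: each factor is switched on or off by the gadget, and one more factor
divides by the number of summation points that all contribute `1` when the condition fails. -/
theorem ite_one (h2 : (2 : F) ≠ 0) {β : (A → Bool) → Bool}
    (hβ : IsBitAffine fun b => bit (F := F) (β b)) {φ : (A → Bool) → MvPolynomial ℕ F} {c : ℕ}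
    (h : CubeRep φ c) : CubeRep (fun b => if β b then φ b else 1) (3 * c + 1) := by
  obtain ⟨B, I, _, _, _, _, ψ, hψ, hc, h⟩ := h
  have hproj : ∀ {χ : (A ⊕ B → Bool) → MvPolynomial ℕ F}, IsBitAffine χ →
      IsBitAffine fun b : A ⊕ (B ⊕ I) → Bool => χ (b ∘ Sum.map id Sum.inl) :=
    fun h => h.comp fun _ => IsBitAffine.apply _
  have hinl : IsBitAffine fun b : A ⊕ (B ⊕ I) → Bool => bit (F := F) (β (b ∘ Sum.inl)) :=
    hβ.comp fun _ => IsBitAffine.apply _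
  refine ⟨B ⊕ I, (I ⊕ I) ⊕ Unit, inferInstance, inferInstance, inferInstance, inferInstance,
    Sum.elim
      (Sum.elim
        (fun i b => C (1 / 2) * ψ i (b ∘ Sum.map id Sum.inl) - bit (b (.inr (.inr i))))
        (fun i b => 1 - C 2 * bit (b (.inr (.inr i))) + bit (β (b ∘ Sum.inl))))
      (fun _ b => bit (β (b ∘ Sum.inl)) + C ((1 / 2) ^ Fintype.card B) * bit (!β (b ∘ Sum.inl))),
    ?_, ?_, fun b => ?_⟩
  · rintro ((i | i) | i)
    · exact ((hproj (hψ i)).const_mul _).sub (IsBitAffine.apply _)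
    · exact (IsBitAffine.one.sub ((IsBitAffine.apply _).const_mul _)).add hinl
    · exact hinl.add (hinl.bit_not.const_mul _)
  · simp only [Fintype.card_sum, Fintype.card_unit]; omega
  · have e (x : B → Bool) (y : I → Bool) :
        Sum.elim b (Sum.elim x y) ∘ Sum.map id Sum.inl = Sum.elim b x := by
      ext (_ | _) <;> rfl
    simp only [sum_sum_elim, Fintype.prod_sum_type, Sum.elim_inl, Sum.elim_inr, e,
      Sum.elim_comp_inl, Finset.univ_unique, Finset.prod_const, Finset.card_singleton, pow_one]
    have key (x : B → Bool) :
        ∑ y : I → Bool, (∏ i, (C (1 / 2) * ψ i (Sum.elim b x) - bit (y i))) *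
          ∏ i, (1 - C 2 * bit (y i) + bit (β b)) = ∏ i, if β b then ψ i (Sum.elim b x) else 1 := by
      simp only [← sum_ite_gadget h2, Finset.prod_univ_sum, Fintype.piFinset_univ,
        Finset.prod_mul_distrib]
    simp only [← Finset.sum_mul, key]
    cases β b
    · have : ((2 : MvPolynomial ℕ F) ^ Fintype.card B * C ((1 / 2) ^ Fintype.card B)) = 1 := by
        have h' : (2 : MvPolynomial ℕ F) = C 2 := (map_ofNat C 2).symm
        rw [h', ← C_pow, ← C_mul, ← mul_pow, one_div, mul_inv_cancel₀ h2, one_pow, C_1]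
      simpa using this.symm
    · simp [h]

theorem ite_bit_eq (h2 : (2 : F) ≠ 0) {β γ : (A → Bool) → Bool}
    (hβ : IsBitAffine fun b => bit (F := F) (β b)) (hγ : IsBitAffine fun b => bit (F := F) (γ b)) :
    CubeRep (fun b => if β b = γ b then (1 : MvPolynomial ℕ F) else 0) 8 := by
  convert (ite_one h2 hβ (of_isBitAffine hγ)).mul
    (ite_one h2 hβ.bit_not (of_isBitAffine hγ.bit_not)) using 2 with b
  cases β b <;> cases γ b <;> simp

open Classical in
/-- The indicator of the event that exactly one of the bits is set. -/
theorem oneHot (h2 : (2 : F) ≠ 0) :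
    CubeRep (fun b : A → Bool => if ∃ a, b = fun a' => decide (a' = a) then
      (1 : MvPolynomial ℕ F) else 0)
      (Fintype.card A * (Fintype.card A * 4) + 1) := by
  have h := (prod (F := F) (A := A) Finset.univ fun a _ => prod Finset.univ fun a' _ =>
    ite_one h2 (β := fun b => b a && decide (a ≠ a')) ?_
      (of_isBitAffine (IsBitAffine.bit_not (IsBitAffine.apply a')))).mul
    (of_isBitAffine (IsBitAffine.sum Finset.univ fun a _ => IsBitAffine.apply (F := F) a))
  · refine Eq.subst (motive := fun φ => CubeRep φ _) (funext fun b => ?_) h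
    -- Given that at most one bit is set, the sum of all bits is the indicator of one being set.
    by_cases hex : ∃ a, b a = true
    · obtain ⟨a, ha⟩ := hex
      by_cases huniq : ∀ a', b a' = true → a' = a
      · have hb : b = fun a' => decide (a' = a) := by
          ext a'
          by_cases h : a' = a
          · simp [h, ha]
          · simpa [h] using fun h' => h (huniq a' h')
        rw [if_pos ⟨a, hb⟩, Finset.prod_eq_one, Finset.sum_eq_single a]
        · simp [ha]
        · intro a' _ h; simp [hb, h]
        · simp
        · intro a₁ _
          refine Finset.prod_eq_one fun a₂ _ => ?_
          rw [hb]
          by_cases h₁ : a₁ = a <;> by_cases h₂ : a₂ = a <;> simp [h₁, h₂]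
      · push Not at huniq
        obtain ⟨a', ha', hne⟩ := huniq
        rw [if_neg, Finset.prod_eq_zero (Finset.mem_univ a), zero_mul]
        · refine Finset.prod_eq_zero (Finset.mem_univ a') ?_
          simp [ha, ha', hne.symm]
        · rintro ⟨a₀, rfl⟩
          simp only [decide_eq_true_eq] at ha ha'
          exact hne (ha'.trans ha.symm)
    · push Not at hex
      rw [if_neg]
      · simp [hex]
      · rintro ⟨a, rfl⟩
        exact hex a (by simp)
  · by_cases h : a = a'
    · simpa [h] using IsBitAffine.bit_const (F := F) (A := A) false
    · simpa [h] using IsBitAffine.apply (F := F) a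

open Classical in
/-- A sum over `R`, with the summand chosen by a one-hot vector of summation bits. -/
theorem sum (h2 : (2 : F) ≠ 0) {R : Type} [Fintype R]
    {φ : R → (A → Bool) → MvPolynomial ℕ F} {c : ℕ} (h : ∀ r, CubeRep (φ r) c) :
    CubeRep (fun b => ∑ r, φ r b)
      (Fintype.card R + (Fintype.card R * (Fintype.card R * 4) + 1 +
        Fintype.card R * (3 * c + 1))) := by
  have hone := oneHot (F := F) (A := R) h2
  generalize hχ : (fun b : R → Bool => if ∃ a, b = fun a' => decide (a' = a) then
    (1 : MvPolynomial ℕ F) else 0) = χ at hone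
  have key : CubeRep (fun b : A ⊕ R → Bool =>
      χ (b ∘ Sum.inr) * ∏ r, if b (.inr r) then φ r (b ∘ Sum.inl) else 1)
      (Fintype.card R * (Fintype.card R * 4) + 1 + Fintype.card R * (3 * c + 1)) :=
    (hone.comp fun _ => IsBitAffine.apply _).mul
      (prod Finset.univ fun r _ => ite_one h2 (IsBitAffine.apply (A := A ⊕ R) (.inr r))
        ((h r).comp fun _ => IsBitAffine.apply _))
  refine Eq.subst (motive := fun φ => CubeRep φ _) (funext fun b => ?_) key.sum_bits
  simp only [Sum.elim_comp_inr, Sum.elim_comp_inl, Sum.elim_inr, ← hχ, ite_mul, one_mul,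
    zero_mul]
  rw [← Finset.sum_filter]
  symm
  refine Finset.sum_bij (fun r _ => fun r' => decide (r' = r)) ?_ ?_ ?_ ?_
  · exact fun r _ => Finset.mem_filter.2 ⟨Finset.mem_univ _, r, rfl⟩
  · intro r _ r' _ h
    simpa using congrFun h r
  · intro e he
    obtain ⟨r, hr⟩ := (Finset.mem_filter.1 he).2
    exact ⟨r, Finset.mem_univ _, hr.symm⟩
  · intro r _
    simp

end CubeRep

end CubeRep

/-! ### Quadratic systems and their derivations -/

/-- The cost of a sum of `r` functions of cost `c` each, see `CubeRep.sum`. -/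
def choiceCost (r c : ℕ) : ℕ := r + (r * (r * 4) + 1 + r * (3 * c + 1))

/-- A sum over rules `r` of `w r b * φ (θ r b)`, in which all rules share a single copy of `φ`,
applied to a guessed vector of bits that is checked to be `θ r b`. In particular the cost of `φ`
enters additively. -/
theorem CubeRep.sum_mul_comp (h2 : (2 : F) ≠ 0) {A K R : Type} [Fintype A] [Fintype K]
    [DecidableEq K] [Fintype R] {w : R → (A → Bool) → MvPolynomial ℕ F} {c c' : ℕ}
    (hw : ∀ r, CubeRep (w r) c) {θ : R → (A → Bool) → K → Bool}
    (hθ : ∀ r k, IsBitAffine fun b => bit (F := F) (θ r b k))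
    {φ : (K → Bool) → MvPolynomial ℕ F} (hφ : CubeRep φ c') :
    CubeRep (fun b => ∑ r, w r b * φ (θ r b))
      (Fintype.card K + (choiceCost (Fintype.card R) (c + Fintype.card K * 8) + c')) := by
  have key : CubeRep (fun b : A ⊕ K → Bool =>
      (∑ r, w r (b ∘ Sum.inl) *
        ∏ k, if b (.inr k) = θ r (b ∘ Sum.inl) k then (1 : MvPolynomial ℕ F) else 0) *
        φ (b ∘ Sum.inr)) (choiceCost (Fintype.card R) (c + Fintype.card K * 8) + c') :=
    (CubeRep.sum h2 fun r => ((hw r).comp fun _ => IsBitAffine.apply _).mul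
      (CubeRep.prod Finset.univ fun k _ => CubeRep.ite_bit_eq h2 (IsBitAffine.apply _)
        ((hθ r k).comp fun _ => IsBitAffine.apply _))).mul
      (hφ.comp fun _ => IsBitAffine.apply _)
  refine Eq.subst (motive := fun φ => CubeRep φ _) (funext fun b => ?_) key.sum_bits
  simp only [Sum.elim_comp_inl, Sum.elim_comp_inr, Sum.elim_inr, Finset.sum_mul]
  rw [Finset.sum_comm]
  refine Finset.sum_congr rfl fun r _ => ?_
  rw [Finset.sum_eq_single (θ r b)]
  · simp
  · intro b' _ hne
    obtain ⟨k, hk⟩ := Function.ne_iff.1 hne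
    rw [Finset.prod_eq_zero (Finset.mem_univ k) (if_neg hk), mul_zero, zero_mul]
  · simp

/-- Polynomials indexed by `W`, each with a positive degree, that satisfy a system of quadratic
equations: a polynomial of degree at least two is a linear combination of products of two of the
polynomials whose degrees add up to its own; a polynomial of degree one is affine.
Equivalently, a weighted context-free grammar in Chomsky normal form. -/
structure QuadraticSystem (F : Type*) [Field F] (W : Type) [Fintype W] where
  /-- the polynomials -/
  val : W → MvPolynomial ℕ F
  /-- their degrees -/
  deg : W → ℕ
  /-- the affine part of the right-hand side of an equation -/
  leaf : W → MvPolynomial ℕ F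
  /-- the coefficients of the quadratic part of the right-hand side -/
  coef : W → W → W → F
  deg_pos : ∀ w, 0 < deg w
  isAffineForm_leaf : ∀ w, IsAffineForm (leaf w)
  deg_of_leaf : ∀ w, leaf w ≠ 0 → deg w = 1
  deg_of_coef : ∀ w u v, coef w u v ≠ 0 → deg u + deg v = deg w
  val_eq : ∀ w, val w = leaf w + ∑ u, ∑ v, C (coef w u v) * (val u * val v)

namespace QuadraticSystem

section Stack

variable {W : Type} [DecidableEq W] {D : ℕ}

/-- A stack, that is, a list of symbols, encoded in bits: the bit at `(p, w)` says that the symbol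
in position `p` is `w`. Only the positions `0, …, D` are kept. -/
def stack (D : ℕ) (L : List W) (k : Fin (D + 1) × W) : Bool := decide (L[(k.1 : ℕ)]? = some k.2)

/-- Remove the top of an encoded stack. -/
def pop (b : Fin (D + 1) × W → Bool) (k : Fin (D + 1) × W) : Bool :=
  if h : (k.1 : ℕ) + 1 < D + 1 then b (⟨k.1 + 1, h⟩, k.2) else false

/-- Replace the top of an encoded stack by two symbols. -/
def expand (u v : W) (b : Fin (D + 1) × W → Bool) (k : Fin (D + 1) × W) : Bool :=
  if (k.1 : ℕ) = 0 then decide (u = k.2) else if (k.1 : ℕ) = 1 then decide (v = k.2)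
    else b (⟨k.1 - 1, by omega⟩, k.2)

theorem pop_stack {w : W} {L : List W} (h : (w :: L).length ≤ D) :
    pop (stack D (w :: L)) = stack D L := by
  ext ⟨⟨p, hp⟩, w'⟩
  simp only [pop, stack]
  split_ifs with hD
  · simp
  · rw [List.getElem?_eq_none (by simp at h; omega)]
    simp

theorem expand_stack (u v w : W) (L : List W) :
    expand u v (stack D (w :: L)) = stack D (u :: v :: L) := by
  ext ⟨⟨p, hp⟩, w'⟩
  match p with
  | 0 => simp [expand, stack]
  | 1 => simp [expand, stack]
  | p + 2 => simp [expand, stack]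

end Stack

variable {W : Type} [Fintype W] {D : ℕ}

theorem isBitAffine_pop (k : Fin (D + 1) × W) :
    IsBitAffine fun b : Fin (D + 1) × W → Bool => bit (F := F) (pop b k) := by
  unfold pop
  split_ifs
  · exact IsBitAffine.apply _
  · exact IsBitAffine.bit_const _

variable [DecidableEq W]

theorem isBitAffine_expand (u v : W) (k : Fin (D + 1) × W) :
    IsBitAffine fun b : Fin (D + 1) × W → Bool => bit (F := F) (expand u v b k) := by
  unfold expand
  split_ifs
  · exact IsBitAffine.bit_const _
  · exact IsBitAffine.bit_const _
  · exact IsBitAffine.apply _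

variable (G : QuadraticSystem F W)

/-- The total weight of the leftmost derivations with exactly `t` steps that start from the stack
encoded by `b`. A step either replaces the top `w` of the stack by two symbols `u, v`, with weight
`G.coef w u v`, or removes it, with weight `G.leaf w`. -/
noncomputable def derivations (D : ℕ) : ℕ → (Fin (D + 1) × W → Bool) → MvPolynomial ℕ F
  | 0, _ => 1
  | t + 1, b => ∑ r : W ⊕ (W × W × W),
      (bit (b (0, r.elim id Prod.fst)) * r.elim G.leaf fun r => C (G.coef r.1 r.2.1 r.2.2)) *
        derivations D t (r.elim (fun _ => pop b) fun r => expand r.2.1 r.2.2 b)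

/-- The number of steps in a derivation from `w`: a binary tree with `deg w` leaves has
`2 * deg w - 1` nodes. -/
def steps (w : W) : ℕ := 2 * G.deg w - 1

/-- The derivations counted here all end in the empty stack: a rule of nonzero weight lowers the sum
of `G.steps` over the stack by exactly one, and that sum vanishes for the empty stack only. The sum
of the degrees never increases, so that `D + 1` positions suffice. -/
theorem derivations_stack (t : ℕ) (L : List W) (ht : (L.map G.steps).sum = t)
    (hD : (L.map G.deg).sum ≤ D) : G.derivations D t (stack D L) = (L.map G.val).prod := by
  induction t generalizing L with
  | zero =>
    cases L with
    | nil => simp [derivations]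
    | cons w L =>
      have := G.deg_pos w
      simp only [List.map_cons, List.sum_cons, steps] at ht
      omega
  | succ t ih =>
    cases L with
    | nil => simp at ht
    | cons w L =>
      have hw := G.deg_pos w
      have hlen : L.length ≤ (L.map G.deg).sum := by
        simpa using List.length_le_sum_of_one_le (L.map G.deg) (by
          simp only [List.mem_map]
          rintro _ ⟨w, _, rfl⟩
          exact G.deg_pos w)
      simp only [List.map_cons, List.sum_cons, steps] at ht hD
      have hbit (w' : W) : bit (F := F) (stack D (w :: L) (0, w')) = if w = w' then 1 else 0 := by
        by_cases h : w = w' <;> simp [stack, h]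
      have hleaf : G.leaf w * G.derivations D t (stack D L) =
          G.leaf w * (L.map G.val).prod := by
        by_cases h : G.leaf w = 0
        · simp [h]
        · have := G.deg_of_leaf w h
          rw [ih L (by omega) (by omega)]
      have hcoef (u v : W) : C (G.coef w u v) * G.derivations D t (stack D (u :: v :: L)) =
          C (G.coef w u v) * (G.val u * G.val v) * (L.map G.val).prod := by
        by_cases h : G.coef w u v = 0
        · simp [h]
        · have := G.deg_of_coef w u v h
          have hu := G.deg_pos u
          have hv := G.deg_pos v
          rw [ih (u :: v :: L) (by simp only [List.map_cons, List.sum_cons, steps]; omega)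
            (by simp only [List.map_cons, List.sum_cons]; omega)]
          simp only [List.map_cons, List.prod_cons]
          ring
      simp only [derivations, Fintype.sum_sum_type, Fintype.sum_prod_type, Sum.elim_inl,
        Sum.elim_inr, id]
      simp only [hbit, expand_stack, pop_stack (D := D) (w := w) (L := L)
          (by simp only [List.length_cons]; omega), ite_mul, one_mul, zero_mul,
        List.map_cons, List.prod_cons]
      rw [Finset.sum_eq_single w (fun w' _ h => if_neg h.symm) (by simp),
        Finset.sum_eq_single w (fun w' _ h => by simp [h.symm]) (by simp)]
      simp only [if_true, hleaf, hcoef]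
      rw [G.val_eq w, add_mul, Finset.sum_mul]
      simp only [Finset.sum_mul]

/-- The cost of a single derivation step, for `W` of cardinality `w`. -/
def stepCost (w D : ℕ) : ℕ :=
  (D + 1) * w + choiceCost (w + w * (w * w)) (2 + (D + 1) * w * 8)

theorem cubeRep_derivations (h2 : (2 : F) ≠ 0) (D t : ℕ) :
    CubeRep (G.derivations D t) (t * stepCost (Fintype.card W) D) := by
  induction t with
  | zero => simpa [derivations] using CubeRep.one
  | succ t ih =>
    refine (CubeRep.sum_mul_comp h2 (fun r => ?_) (fun r k => ?_) ih).mono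
      (c := _ + (choiceCost _ (2 + _) + _)) ?_
    · refine (CubeRep.of_isBitAffine (IsBitAffine.apply _)).mul (CubeRep.of_isBitAffine ?_)
      rcases r with r | r
      · exact IsBitAffine.of_isAffineForm (G.isAffineForm_leaf r)
      · exact IsBitAffine.const _
    · rcases r with r | r
      · exact isBitAffine_pop k
      · exact isBitAffine_expand _ _ k
    · simp only [Fintype.card_prod, Fintype.card_sum, Fintype.card_fin, stepCost]
      exact le_of_eq (by ring)

theorem cubeRep_val (h2 : (2 : F) ≠ 0) {A : Type} [Fintype A] (w : W) (hw : G.deg w ≤ D) :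
    CubeRep (fun _ : A → Bool => G.val w) (2 * D * stepCost (Fintype.card W) D) := by
  have h := (G.cubeRep_derivations h2 D (G.steps w)).comp (A := A) (θ := fun _ => stack D [w])
    fun k => IsBitAffine.bit_const _
  rw [G.derivations_stack _ [w] (by simp) (by simpa using hw)] at h
  simp only [List.map_cons, List.map_nil, List.prod_singleton] at h
  exact h.mono (Nat.mul_le_mul_right _ (by simp only [steps]; omega))

end QuadraticSystem

theorem IsAffineForm.eq_sum {l : MvPolynomial ℕ F} (hl : IsAffineForm l) :
    l = C (coeff 0 l) + ∑ i ∈ l.vars, C (coeff (Finsupp.single i 1) l) * X i := by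
  ext m
  simp only [coeff_add, coeff_C, coeff_sum, coeff_C_mul, coeff_X]
  by_cases h0 : m = 0
  · subst h0
    simp
  by_cases h1 : ∃ j, m = Finsupp.single j 1
  · obtain ⟨j, rfl⟩ := h1
    rw [if_neg (Ne.symm h0), zero_add, Finset.sum_eq_single j]
    · simp
    · intro i _ hij
      rw [if_neg (fun h => hij (Finsupp.single_left_injective one_ne_zero h)), mul_zero]
    · intro hj
      have : coeff (Finsupp.single j 1) l = 0 := by
        by_contra h
        exact hj ((mem_vars_iff_mem_support j).2
          ⟨_, mem_support_iff.2 h, by simp⟩)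
      simp [this]
  · rw [if_neg (Ne.symm h0), zero_add, Finset.sum_eq_zero]
    · apply coeff_eq_zero_of_totalDegree_lt
      refine lt_of_le_of_lt hl ?_
      change 1 < m.degree
      have h0' : m.degree ≠ 0 := by simpa [Finsupp.degree_eq_zero_iff] using h0
      have h1' : m.degree ≠ 1 := fun h => h1 ((Finsupp.sum_eq_one_iff m).1 h)
      omega
    · intro i _
      rw [if_neg (fun h => h1 ⟨i, h.symm⟩), mul_zero]

/-! ### Circuits as quadratic systems -/

theorem homogeneousComponent_mul_mem {S : Submodule F (MvPolynomial ℕ F)} {k : ℕ}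
    {p q : MvPolynomial ℕ F} (h : ∀ a b, a + b = k →
      homogeneousComponent a p * homogeneousComponent b q ∈ S) :
    homogeneousComponent k (p * q) ∈ S := by
  rw [← sum_homogeneousComponent p, ← sum_homogeneousComponent q, Finset.sum_mul_sum]
  simp only [map_sum]
  refine Submodule.sum_mem _ fun a _ => Submodule.sum_mem _ fun b _ => ?_
  rw [homogeneousComponent_of_mem ((homogeneousComponent_isHomogeneous a p).mul
    (homogeneousComponent_isHomogeneous b q))]
  split_ifs with hk
  · exact h a b hk.symm
  · exact S.zero_mem

/-- A homogeneous component of degree `k ≥ 2` at a gate of a circuit is a linear combination of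
products of homogeneous components of smaller positive degrees: in the component of a product
gate, the terms with a factor of degree zero are scalar multiples of components of degree `k` at
earlier gates. -/
theorem IsCircuit.homogeneousComponent_mem_span {s : ℕ} {r : Fin s → MvPolynomial ℕ F}
    (hr : IsCircuit r) {d k : ℕ} (hk : 2 ≤ k) (hd : k ≤ d) (i : Fin s) :
    homogeneousComponent k (r i) ∈ Submodule.span F (Set.range
      fun p : (Fin s × Fin d) × (Fin s × Fin d) =>
        if (p.1.2 + 1 : ℕ) + (p.2.2 + 1) = k then
          homogeneousComponent (p.1.2 + 1) (r p.1.1) * homogeneousComponent (p.2.2 + 1) (r p.2.1)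
        else 0) := by
  induction i using WellFoundedLT.induction with
  | ind i ih =>
    rcases hr i with ⟨a, h⟩ | ⟨x, h⟩ | ⟨j, hj, l, hl, h⟩ | ⟨j, hj, l, hl, h⟩
    · rw [h, homogeneousComponent_eq_zero _ _ (by simp; omega)]
      exact Submodule.zero_mem _
    · rw [h, homogeneousComponent_eq_zero _ _ (by simp; omega)]
      exact Submodule.zero_mem _
    · rw [h, map_add]
      exact Submodule.add_mem _ (ih j hj) (ih l hl)
    · rw [h]
      refine homogeneousComponent_mul_mem fun a b hab => ?_
      rcases a.eq_zero_or_pos with rfl | ha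
      · obtain rfl : b = k := by omega
        rw [homogeneousComponent_zero, ← smul_eq_C_mul]
        exact Submodule.smul_mem _ _ (ih l hl)
      rcases b.eq_zero_or_pos with rfl | hb
      · obtain rfl : a = k := by omega
        rw [homogeneousComponent_zero, mul_comm, ← smul_eq_C_mul]
        exact Submodule.smul_mem _ _ (ih j hj)
      · refine Submodule.subset_span
          ⟨((j, ⟨a - 1, by omega⟩), (l, ⟨b - 1, by omega⟩)), ?_⟩
        simp only [Nat.sub_add_cancel ha, Nat.sub_add_cancel hb, if_pos hab]

/-- The homogeneous components of degrees `1, …, d` at the gates of a circuit form a quadratic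
system. -/
theorem IsCircuit.exists_quadraticSystem {s : ℕ} {r : Fin s → MvPolynomial ℕ F}
    (hr : IsCircuit r) (d : ℕ) : ∃ G : QuadraticSystem F (Fin s × Fin d),
      (∀ w, G.val w = homogeneousComponent (w.2 + 1) (r w.1)) ∧ ∀ w, G.deg w = w.2 + 1 := by
  have h (w : Fin s × Fin d) : ∃ c : (Fin s × Fin d) × (Fin s × Fin d) → F,
      homogeneousComponent (w.2 + 1) (r w.1) =
        (if (w.2 : ℕ) = 0 then homogeneousComponent (w.2 + 1) (r w.1) else 0) +
        ∑ p, c p • if (p.1.2 + 1 : ℕ) + (p.2.2 + 1) = w.2 + 1 then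
          homogeneousComponent (p.1.2 + 1) (r p.1.1) * homogeneousComponent (p.2.2 + 1) (r p.2.1)
        else 0 := by
    by_cases hw : (w.2 : ℕ) = 0
    · exact ⟨0, by simp [hw]⟩
    · obtain ⟨c, hc⟩ := (Submodule.mem_span_range_iff_exists_fun F).1
        (hr.homogeneousComponent_mem_span (k := w.2 + 1) (by omega)
          (Nat.succ_le_of_lt w.2.isLt) w.1)
      exact ⟨c, by rw [if_neg hw, zero_add, hc]⟩
  choose c hc using h
  refine ⟨{
    val := fun w => homogeneousComponent (w.2 + 1) (r w.1)
    deg := fun w => w.2 + 1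
    leaf := fun w => if (w.2 : ℕ) = 0 then homogeneousComponent (w.2 + 1) (r w.1) else 0
    coef := fun w u v => if (u.2 + 1 : ℕ) + (v.2 + 1) = w.2 + 1 then c w (u, v) else 0
    deg_pos := fun w => by omega
    isAffineForm_leaf := fun w => ?_
    deg_of_leaf := fun w h => ?_
    deg_of_coef := fun w u v h => ?_
    val_eq := fun w => ?_ }, fun _ => rfl, fun _ => rfl⟩
  · split_ifs with h
    · exact (homogeneousComponent_isHomogeneous _ _).totalDegree_le.trans (by omega)
    · simp [IsAffineForm]
  · by_contra h'
    exact h (if_neg (by omega))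
  · by_contra h'
    exact h (if_neg h')
  · refine (hc w).trans ?_
    rw [Fintype.sum_prod_type]
    refine congrArg _ (Finset.sum_congr rfl fun u _ => Finset.sum_congr rfl fun v _ => ?_)
    split_ifs
    · rw [smul_eq_C_mul]
    · simp

/-- The cost of a polynomial of degree at most `d` with a circuit of size `s`. -/
def circuitCost (s d : ℕ) : ℕ :=
  choiceCost (d + 1) (2 * d * QuadraticSystem.stepCost (s * d) d + 1)

theorem ComputedByCircuit.cubeRep (h2 : (2 : F) ≠ 0) {A : Type} [Fintype A]
    {f : MvPolynomial ℕ F} {s d : ℕ} (hf : ComputedByCircuit f s) (hd : f.totalDegree ≤ d) :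
    CubeRep (fun _ : A → Bool => f) (circuitCost s d) := by
  obtain ⟨r, hr, i, rfl⟩ := hf
  obtain ⟨G, hval, hdeg⟩ := hr.exists_quadraticSystem d
  have hsum : r i = ∑ k : Fin (d + 1), homogeneousComponent k (r i) := by
    rw [Fin.sum_univ_eq_sum_range (fun k => homogeneousComponent k (r i))]
    conv_lhs => rw [← sum_homogeneousComponent (r i)]
    refine Finset.sum_subset (by simpa using hd) fun k _ hk => ?_
    exact homogeneousComponent_eq_zero _ _ (by simpa using hk)
  have key (k : Fin (d + 1)) : CubeRep (fun _ : A → Bool => homogeneousComponent k (r i))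
      (2 * d * QuadraticSystem.stepCost (s * d) d + 1) := by
    obtain ⟨k, hk⟩ := k
    rcases k with _ | k
    · simp only [homogeneousComponent_zero]
      exact (CubeRep.of_isBitAffine (IsBitAffine.const _)).mono (by omega)
    · have h := G.cubeRep_val (D := d) h2 (A := A) (i, ⟨k, by omega⟩) (by rw [hdeg]; simpa using hk)
      rw [hval] at h
      refine h.mono ?_
      simp only [Fintype.card_prod, Fintype.card_fin]
      omega
  have h := CubeRep.sum h2 key
  simp only [← hsum, Fintype.card_fin] at h
  exact h

/-! ### Hypercube sums -/

theorem isBitAffine_bind₁ {p : ℕ} {l : MvPolynomial ℕ F} (hl : IsAffineForm l) :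
    IsBitAffine fun b : Fin p → Bool => bind₁ (cubeSubst b) l := by
  have hX (i : ℕ) : IsBitAffine fun b : Fin p → Bool => cubeSubst (F := F) b i := by
    unfold cubeSubst
    split_ifs with h
    · exact IsBitAffine.apply _
    · exact IsBitAffine.of_isAffineForm (by simp [IsAffineForm])
  rw [hl.eq_sum]
  simp only [map_add, map_sum, map_mul, bind₁_C_right, bind₁_X_right]
  exact (IsBitAffine.const _).add (IsBitAffine.sum _ fun i _ => (hX i).const_mul _)

theorem bind₁_bit {σ : ℕ → MvPolynomial ℕ F} (c : Bool) : bind₁ σ (bit c) = bit c := by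
  cases c <;> simp

theorem CubeRep.bind₁_cubeSubst {g : MvPolynomial ℕ F} {c : ℕ}
    (h : CubeRep (fun _ : Empty → Bool => g) c) (p : ℕ) :
    CubeRep (fun b : Fin p → Bool => bind₁ (cubeSubst b) g) c := by
  obtain ⟨B, I, _, _, _, _, ψ, hψ, hc, h⟩ := h
  refine ⟨B, I, inferInstance, inferInstance, inferInstance, inferInstance,
    fun i b => bind₁ (cubeSubst (b ∘ Sum.inl)) (ψ i (Sum.elim Empty.elim (b ∘ Sum.inr))),
    fun i => ?_, hc, fun b => ?_⟩
  · obtain ⟨l, a, hl, h⟩ := hψ i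
    simp only [h, map_add, map_sum, map_mul, bind₁_C_right, bind₁_bit]
    refine ((isBitAffine_bind₁ hl).comp fun _ => IsBitAffine.apply _).add
      (IsBitAffine.sum _ fun k _ => IsBitAffine.const_mul _ ?_)
    rcases k with k | k
    · exact k.elim
    · exact IsBitAffine.apply _
  · refine (congrArg _ (h Empty.elim)).trans ?_
    simp only [map_sum, map_prod, Sum.elim_comp_inl, Sum.elim_comp_inr]

theorem CubeRep.hypercubeSum {g : MvPolynomial ℕ F} {c : ℕ}
    (h : CubeRep (fun _ : Empty → Bool => g) c) (p : ℕ) :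
    CubeRep (fun _ : Empty → Bool => hypercubeSum p g) (p + c) := by
  have := ((h.bind₁_cubeSubst p).comp (A := Empty ⊕ Fin p) (θ := fun b => b ∘ Sum.inr)
    fun k => IsBitAffine.apply _).sum_bits
  simpa [AlgComplexity.hypercubeSum] using this

/-- A `CubeRep` without free bits is a hypercube sum over a product of affine linear forms. -/
theorem CubeRep.exists_hypercubeSum {f : MvPolynomial ℕ F} {c : ℕ}
    (h : CubeRep (fun _ : Empty → Bool => f) c) :
    ∃ (p m : ℕ) (l : Fin m → MvPolynomial ℕ F), p + m ≤ c ∧ (∀ i, IsAffineForm (l i)) ∧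
      f = AlgComplexity.hypercubeSum p (∏ i, l i) := by
  obtain ⟨B, I, _, _, _, _, ψ, hψ, hc, h⟩ := h
  choose l a hl hψ using hψ
  let e := Fintype.equivFin B
  let e' := Fintype.equivFin I
  refine ⟨Fintype.card B, Fintype.card I, fun i =>
    rename (· + Fintype.card B) (l (e'.symm i)) + ∑ k, C (a (e'.symm i) (.inr k)) * X (e k : ℕ),
    hc, fun i => ?_, ?_⟩
  · refine (totalDegree_add _ _).trans (max_le ((totalDegree_rename_le _ _).trans (hl _)) ?_)
    refine totalDegree_finsetSum_le fun k _ => (totalDegree_mul _ _).trans ?_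
    simp
  · refine (h Empty.elim).trans ?_
    rw [AlgComplexity.hypercubeSum]
    refine Fintype.sum_equiv (e.arrowCongr (Equiv.refl Bool)) _ _ fun b => ?_
    rw [map_prod]
    refine Fintype.prod_equiv e' _ _ fun i => ?_
    have h₁ : cubeSubst (F := F) (e.arrowCongr (Equiv.refl Bool) b) ∘ (· + Fintype.card B) =
        X := by
      ext1 x
      simp [cubeSubst]
    have h₂ (k : B) : cubeSubst (F := F) (e.arrowCongr (Equiv.refl Bool) b) (e k : ℕ) =
        bit (b k) := by
      simp [cubeSubst, bit, Equiv.arrowCongr]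
    simp only [map_add, map_sum, map_mul, bind₁_C_right, bind₁_X_right, bind₁_rename, h₁, h₂,
      hψ, Equiv.symm_apply_apply, Fintype.sum_sum_type]
    simp [bind₁_X_left]

/-! ### Polynomially bounded functions -/

namespace PolyBounded

theorem mono {p q : ℕ → ℕ} (hq : PolyBounded q) (h : ∀ n, p n ≤ q n) : PolyBounded p :=
  hq.imp fun _ hP n => (h n).trans (hP n)

theorem const (c : ℕ) : PolyBounded fun _ => c :=
  ⟨Polynomial.C c, by simp⟩

theorem add {p q : ℕ → ℕ} (hp : PolyBounded p) (hq : PolyBounded q) :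
    PolyBounded fun n => p n + q n := by
  obtain ⟨P, hP⟩ := hp
  obtain ⟨Q, hQ⟩ := hq
  exact ⟨P + Q, fun n => by simpa using add_le_add (hP n) (hQ n)⟩

theorem mul {p q : ℕ → ℕ} (hp : PolyBounded p) (hq : PolyBounded q) :
    PolyBounded fun n => p n * q n := by
  obtain ⟨P, hP⟩ := hp
  obtain ⟨Q, hQ⟩ := hq
  exact ⟨P * Q, fun n => by simpa using Nat.mul_le_mul (hP n) (hQ n)⟩

theorem comp {p q : ℕ → ℕ} (hp : PolyBounded p) (hq : PolyBounded q) :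
    PolyBounded fun n => p (q n) := by
  obtain ⟨P, hP⟩ := hp
  obtain ⟨Q, hQ⟩ := hq
  refine ⟨P.comp Q, fun n => (hP _).trans ?_⟩
  rw [Polynomial.eval_comp]
  simp only [Polynomial.eval_eq_sum, Polynomial.sum]
  refine Finset.sum_le_sum fun i _ => Nat.mul_le_mul_left _ (Nat.pow_le_pow_left ?_ _)
  simpa only [Polynomial.eval_eq_sum, Polynomial.sum] using hQ n

theorem choiceCost {r c : ℕ → ℕ} (hr : PolyBounded r) (hc : PolyBounded c) :
    PolyBounded fun n => choiceCost (r n) (c n) :=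
  hr.add (((hr.mul (hr.mul (const 4))).add (const 1)).add
    (hr.mul (((const 3).mul hc).add (const 1))))

theorem stepCost {w D : ℕ → ℕ} (hw : PolyBounded w) (hD : PolyBounded D) :
    PolyBounded fun n => QuadraticSystem.stepCost (w n) (D n) :=
  ((hD.add (const 1)).mul hw).add (choiceCost (hw.add (hw.mul (hw.mul hw)))
    ((const 2).add (((hD.add (const 1)).mul hw).mul (const 8))))

theorem circuitCost {s d : ℕ → ℕ} (hs : PolyBounded s) (hd : PolyBounded d) :
    PolyBounded fun n => circuitCost (s n) (d n) :=
  choiceCost (hd.add (const 1))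
    ((((const 2).mul hd).mul (stepCost (hs.mul hd) hd)).add (const 1))

end PolyBounded

/-! ### Sizes of circuits -/

theorem IsCircuit.append {s t : ℕ} {r : Fin s → MvPolynomial ℕ F} {u : Fin t → MvPolynomial ℕ F}
    (hr : IsCircuit r) (hu : IsCircuit u) : IsCircuit (Fin.append r u) := by
  intro i
  induction i using Fin.addCases with
  | left i =>
    simp only [Fin.append_left]
    rcases hr i with h | h | ⟨j, hj, k, hk, h⟩ | ⟨j, hj, k, hk, h⟩
    · exact .inl h
    · exact .inr (.inl h)
    · exact .inr (.inr (.inl ⟨j.castAdd t, hj, k.castAdd t, hk, by simpa using h⟩))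
    · exact .inr (.inr (.inr ⟨j.castAdd t, hj, k.castAdd t, hk, by simpa using h⟩))
  | right i =>
    simp only [Fin.append_right]
    rcases hu i with h | h | ⟨j, hj, k, hk, h⟩ | ⟨j, hj, k, hk, h⟩
    · exact .inl h
    · exact .inr (.inl h)
    · exact .inr (.inr (.inl ⟨j.natAdd s, by simpa using hj, k.natAdd s, by simpa using hk,
        by simpa using h⟩))
    · exact .inr (.inr (.inr ⟨j.natAdd s, by simpa using hj, k.natAdd s, by simpa using hk,
        by simpa using h⟩))

theorem IsCircuit.snoc {s : ℕ} {r : Fin s → MvPolynomial ℕ F} (hr : IsCircuit r)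
    {f : MvPolynomial ℕ F} (hf : (∃ a, f = C a) ∨ (∃ x, f = X x) ∨
      (∃ j k, f = r j + r k) ∨ ∃ j k, f = r j * r k) :
    IsCircuit (Fin.snoc r f : Fin (s + 1) → MvPolynomial ℕ F) := by
  intro i
  induction i using Fin.lastCases with
  | last =>
    simp only [Fin.snoc_last]
    rcases hf with h | h | ⟨j, k, h⟩ | ⟨j, k, h⟩
    · exact .inl h
    · exact .inr (.inl h)
    · exact .inr (.inr (.inl ⟨j.castSucc, Fin.castSucc_lt_last j, k.castSucc,
        Fin.castSucc_lt_last k, by simpa using h⟩))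
    · exact .inr (.inr (.inr ⟨j.castSucc, Fin.castSucc_lt_last j, k.castSucc,
        Fin.castSucc_lt_last k, by simpa using h⟩))
  | cast i =>
    simp only [Fin.snoc_castSucc]
    rcases hr i with h | h | ⟨j, hj, k, hk, h⟩ | ⟨j, hj, k, hk, h⟩
    · exact .inl h
    · exact .inr (.inl h)
    · exact .inr (.inr (.inl ⟨j.castSucc, by simpa using hj, k.castSucc, by simpa using hk,
        by simpa using h⟩))
    · exact .inr (.inr (.inr ⟨j.castSucc, by simpa using hj, k.castSucc, by simpa using hk,
        by simpa using h⟩))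

theorem isCircuit_empty (r : Fin 0 → MvPolynomial ℕ F) : IsCircuit r := fun i => i.elim0

namespace ComputedByCircuit

theorem of_snoc {s : ℕ} {r : Fin s → MvPolynomial ℕ F} (hr : IsCircuit r) {f : MvPolynomial ℕ F}
    (hf : (∃ a, f = C a) ∨ (∃ x, f = X x) ∨ (∃ j k, f = r j + r k) ∨ ∃ j k, f = r j * r k) :
    ComputedByCircuit f (s + 1) :=
  ⟨_, hr.snoc hf, Fin.last s, by simp⟩

theorem const (a : F) : ComputedByCircuit (C a) 1 :=
  of_snoc (isCircuit_empty Fin.elim0) (.inl ⟨a, rfl⟩)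

theorem var (x : ℕ) : ComputedByCircuit (X x : MvPolynomial ℕ F) 1 :=
  of_snoc (isCircuit_empty Fin.elim0) (.inr (.inl ⟨x, rfl⟩))

theorem add {f g : MvPolynomial ℕ F} {s t : ℕ} (hf : ComputedByCircuit f s)
    (hg : ComputedByCircuit g t) : ComputedByCircuit (f + g) (s + t + 1) := by
  obtain ⟨r, hr, i, rfl⟩ := hf
  obtain ⟨u, hu, j, rfl⟩ := hg
  exact of_snoc (hr.append hu) (.inr (.inr (.inl ⟨i.castAdd t, j.natAdd s, by simp⟩)))

theorem mul {f g : MvPolynomial ℕ F} {s t : ℕ} (hf : ComputedByCircuit f s)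
    (hg : ComputedByCircuit g t) : ComputedByCircuit (f * g) (s + t + 1) := by
  obtain ⟨r, hr, i, rfl⟩ := hf
  obtain ⟨u, hu, j, rfl⟩ := hg
  exact of_snoc (hr.append hu) (.inr (.inr (.inr ⟨i.castAdd t, j.natAdd s, by simp⟩)))

theorem of_isAffineForm {l : MvPolynomial ℕ F} (hl : IsAffineForm l) :
    ComputedByCircuit l (4 * l.vars.card + 1) := by
  have h (a : F) (c : ℕ → F) (S : Finset ℕ) :
      ComputedByCircuit (C a + ∑ i ∈ S, C (c i) * X i) (4 * S.card + 1) := by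
    induction S using Finset.induction_on with
    | empty => simpa using const a
    | insert i S hi ih =>
      rw [Finset.sum_insert hi, Finset.card_insert_of_notMem hi, add_left_comm]
      convert ((const (c i)).mul (var i)).add ih using 1
      ring
  simpa only [← hl.eq_sum] using h (coeff 0 l) (fun i => coeff (Finsupp.single i 1) l) l.vars

theorem prod {ι : Type*} (S : Finset ι) {f : ι → MvPolynomial ℕ F} {c : ℕ}
    (h : ∀ i ∈ S, ∃ s ≤ c, ComputedByCircuit (f i) s) :
    ∃ s ≤ S.card * (c + 1) + 1, ComputedByCircuit (∏ i ∈ S, f i) s := by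
  classical
  induction S using Finset.induction_on with
  | empty => exact ⟨1, by simp, by simpa using const (1 : F)⟩
  | insert i S hi ih =>
    obtain ⟨s, hs, h₁⟩ := h i (by simp)
    obtain ⟨t, ht, h₂⟩ := ih fun j hj => h j (by simp [hj])
    refine ⟨s + t + 1, ?_, by simpa [Finset.prod_insert hi] using h₁.mul h₂⟩
    rw [Finset.card_insert_of_notMem hi, Nat.succ_mul]
    omega

end ComputedByCircuit

/-! ### Branching programs of width one -/

namespace ABP

/-- In a branching program of width one, distinct vertices lie in distinct layers, so there is at
most one path from the source to the sink. -/
theorem exists_value_eq_prod {Γ : ABP F} (h : Γ.width = 1) :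
    Γ.value = 0 ∨ ∃ (m : ℕ) (l : Fin m → MvPolynomial ℕ F), m ≤ Γ.size ∧
      (∀ i, IsAffineForm (l i)) ∧ Γ.value = ∏ i, l i := by
  classical
  have hinj : Function.Injective Γ.layer := by
    intro u v huv
    have hle := Finset.le_sup (f := fun v : Fin Γ.size =>
      (Finset.univ.filter fun u : Fin Γ.size => Γ.layer u = Γ.layer v).card) (Finset.mem_univ v)
    refine Finset.card_le_one.1 (hle.trans_eq h) u (by simpa using huv) v (by simp)
  have hlayer {γ : Fin (Γ.pathLength + 1) → Fin Γ.size} (hγ : Γ.IsPath γ)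
      (i : Fin (Γ.pathLength + 1)) : Γ.layer (γ i) = Γ.layer Γ.source + (i : ℕ) := by
    induction i using Fin.induction with
    | zero => simp [hγ.1]
    | succ i ih =>
      rw [Γ.layer_edge _ _ (hγ.2.2 i), ih]
      simp [add_assoc]
  by_cases hex : ∃ γ, Γ.IsPath γ
  · obtain ⟨γ, hγ⟩ := hex
    have huniq (γ' : Fin (Γ.pathLength + 1) → Fin Γ.size) (hγ' : Γ.IsPath γ') : γ' = γ :=
      funext fun i => hinj (by rw [hlayer hγ, hlayer hγ'])
    refine .inr ⟨Γ.pathLength, fun i => Γ.label (γ i.castSucc) (γ i.succ), ?_,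
      fun i => Γ.affine_label _ _ (hγ.2.2 i), ?_⟩
    · have hγinj : Function.Injective γ := fun i j hij => by
        have := hlayer hγ i
        rw [hij, hlayer hγ j] at this
        exact Fin.ext (by omega)
      have := Fintype.card_le_of_injective γ hγinj
      simp only [Fintype.card_fin] at this
      omega
    · rw [value, Finset.sum_eq_single_of_mem γ (by simpa using hγ)]
      intro γ' hγ' hne
      exact absurd (huniq γ' (by simpa using hγ')) hne
  · refine .inl ?_
    rw [value, Finset.filter_eq_empty_iff.2 fun γ _ hγ => hex ⟨γ, hγ⟩, Finset.sum_empty]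

/-- The branching program that consists of a single path, with the given edge labels. -/
noncomputable def ofProd {m : ℕ} (l : Fin m → MvPolynomial ℕ F) (hl : ∀ i, IsAffineForm (l i)) :
    ABP F where
  size := m + 1
  layer v := (v : ℕ)
  Edge u v := (v : ℕ) = u + 1
  label u _ := if h : (u : ℕ) < m then l ⟨u, h⟩ else 0
  source := 0
  sink := Fin.last m
  layer_edge u v h := by simp [h]
  affine_label u v h := by
    rw [dif_pos (by omega)]
    exact hl _

variable {m : ℕ} (l : Fin m → MvPolynomial ℕ F) (hl : ∀ i, IsAffineForm (l i))

theorem width_ofProd : (ofProd l hl).width = 1 := by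
  have hinj : Function.Injective (ofProd l hl).layer := fun u v h =>
    Fin.ext (by simpa [ofProd] using h)
  have h (v) : (Finset.univ.filter fun u => (ofProd l hl).layer u = (ofProd l hl).layer v).card =
      1 := Finset.card_eq_one.2 ⟨v, by ext u; simp [hinj.eq_iff]⟩
  simp only [width, h]
  exact Finset.sup_const ⟨(ofProd l hl).source, Finset.mem_univ _⟩ 1

theorem pathLength_ofProd : (ofProd l hl).pathLength = m := by
  simp [pathLength, ofProd]

theorem value_ofProd : (ofProd l hl).value = ∏ i, l i := by
  classical
  have hm := pathLength_ofProd l hl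
  have hpath {γ : Fin ((ofProd l hl).pathLength + 1) → Fin (m + 1)}
      (hγ : (ofProd l hl).IsPath γ) (i) : (γ i : ℕ) = i := by
    induction i using Fin.induction with
    | zero => rw [hγ.1]; rfl
    | succ i ih =>
      have : (γ i.succ : ℕ) = γ i.castSucc + 1 := hγ.2.2 i
      rw [this, ih]
      rfl
  have hmem : (ofProd l hl).IsPath (Fin.cast (by rw [hm]; rfl)) := by
    refine ⟨rfl, Fin.ext ?_, fun i => rfl⟩
    exact hm
  rw [value, Finset.sum_eq_single_of_mem _ (Finset.mem_filter.2 ⟨Finset.mem_univ _, hmem⟩)]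
  · refine Fintype.prod_equiv (finCongr hm) _ _ fun i => ?_
    exact dif_pos (i.isLt.trans_eq hm)
  · intro γ hγ hne
    exact absurd (funext fun i => Fin.ext (hpath (Finset.mem_filter.1 hγ).2 i)) hne

end ABP

/-! ### Restricting the variables -/

/-- The substitution of `0` for all variables outside of `S`. -/
noncomputable def restrictVars (S : Finset ℕ) : MvPolynomial ℕ F →ₐ[F] MvPolynomial ℕ F :=
  bind₁ fun i => if i ∈ S then X i else 0

theorem isAffineForm_restrictVars (S : Finset ℕ) {l : MvPolynomial ℕ F} (hl : IsAffineForm l) :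
    IsAffineForm (restrictVars S l) := by
  rw [hl.eq_sum]
  simp only [restrictVars, map_add, map_sum, map_mul, bind₁_C_right, bind₁_X_right]
  refine (totalDegree_add _ _).trans (max_le (by simp) ?_)
  refine totalDegree_finsetSum_le fun i _ => (totalDegree_mul _ _).trans ?_
  split_ifs <;> simp

theorem vars_restrictVars_subset (S : Finset ℕ) (f : MvPolynomial ℕ F) :
    (restrictVars S f).vars ⊆ S := by
  refine (vars_bind₁ _ _).trans fun i hi => ?_
  obtain ⟨j, _, hj⟩ := Finset.mem_biUnion.1 hi
  split_ifs at hj with h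
  · simp only [vars_X, Finset.mem_singleton] at hj
    exact hj ▸ h
  · simp at hj

theorem restrictVars_eq_self (f : MvPolynomial ℕ F) : restrictVars f.vars f = f := by
  refine hom_congr_vars (f₁ := (restrictVars f.vars : MvPolynomial ℕ F →ₐ[F] _).toRingHom)
    (f₂ := RingHom.id _) ?_ (fun i hi _ => ?_) rfl
  · ext1 a
    simp [restrictVars]
  · simp [restrictVars, hi]

theorem restrictVars_hypercubeSum (S : Finset ℕ) (p : ℕ) (g : MvPolynomial ℕ F) :
    restrictVars S (hypercubeSum p g) =
      hypercubeSum p (restrictVars (Finset.range p ∪ S.image (· + p)) g) := by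
  simp only [hypercubeSum, map_sum, restrictVars, bind₁_bind₁]
  refine Finset.sum_congr rfl fun b _ => ?_
  congr 2
  ext1 i
  by_cases hi : i < p
  · simp only [cubeSubst, Finset.mem_union, Finset.mem_range, hi, true_or, if_true,
      bind₁_X_right]
    split_ifs <;> simp
  · have hmem : i ∈ S.image (· + p) ↔ i - p ∈ S := by
      rw [Finset.mem_image]
      exact ⟨fun ⟨j, hj, h⟩ => by simpa [← h] using hj,
        fun h => ⟨i - p, h, by omega⟩⟩
    by_cases hS : i - p ∈ S <;> simp [cubeSubst, hi, hmem, hS]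

theorem card_vars_hypercubeSum_le (p : ℕ) (g : MvPolynomial ℕ F) :
    (hypercubeSum p g).vars.card ≤ g.vars.card := by
  refine (Finset.card_le_card (t := g.vars.image (· - p)) fun i hi => ?_).trans
    Finset.card_image_le
  obtain ⟨b, _, hb⟩ := Finset.mem_biUnion.1 (vars_sum_subset _ _ hi)
  obtain ⟨j, hj, h⟩ := Finset.mem_biUnion.1 (vars_bind₁ _ _ hb)
  refine Finset.mem_image.2 ⟨j, hj, ?_⟩
  unfold cubeSubst at h
  split_ifs at h
  · simp at h
  · simp at h
  · rw [vars_X, Finset.mem_singleton] at h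
    exact h.symm

theorem vars_subset_vars_mul {f g : MvPolynomial ℕ F} (hf : f ≠ 0) (hg : g ≠ 0) :
    f.vars ⊆ (f * g).vars := fun i hi => by
  rw [mem_vars_iff_degreeOf_ne_zero] at hi ⊢
  rw [degreeOf_mul_eq hf hg]
  omega

/-! ### The classes -/

theorem VPk_one_subset_VP : VPk F 1 ⊆ VP F := by
  rintro f ⟨hvars, Γ, hsize, hΓ⟩
  have h (n : ℕ) : (f n).totalDegree ≤ (Γ n).size ∧
      ∃ s ≤ (Γ n).size * (4 * (f n).vars.card + 1 + 1) + 1, ComputedByCircuit (f n) s := by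
    rcases ABP.exists_value_eq_prod (hΓ n).1 with h | ⟨m, l, hm, hl, h⟩
    · rw [(hΓ n).2] at h
      rw [h]
      exact ⟨by simp, 1, by simp, by simpa using ComputedByCircuit.const (0 : F)⟩
    rw [(hΓ n).2] at h
    refine ⟨?_, ?_⟩
    · rw [h]
      refine (totalDegree_finsetProd _ _).trans ((Finset.sum_le_card_nsmul _ _ 1 fun i _ =>
        hl i).trans ?_)
      simpa using hm
    · by_cases h0 : f n = 0
      · rw [h0]
        exact ⟨1, by simp, by simpa using ComputedByCircuit.const (0 : F)⟩
      -- A nonzero product contains all variables of its factors.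
      have hsub (i : Fin m) : (l i).vars ⊆ (f n).vars := by
        classical
        have hne := h ▸ h0
        rw [h, ← Finset.mul_prod_erase _ _ (Finset.mem_univ i)]
        rw [← Finset.mul_prod_erase _ _ (Finset.mem_univ i)] at hne
        exact vars_subset_vars_mul (left_ne_zero_of_mul hne) (right_ne_zero_of_mul hne)
      obtain ⟨s, hs, hc⟩ := ComputedByCircuit.prod (c := 4 * (f n).vars.card + 1) Finset.univ
        fun i _ => ⟨_, by have := Finset.card_le_card (hsub i); omega,
          ComputedByCircuit.of_isAffineForm (hl i)⟩
      refine ⟨s, hs.trans ?_, h ▸ hc⟩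
      rw [Finset.card_univ, Fintype.card_fin]
      exact Nat.succ_le_succ (Nat.mul_le_mul_right _ hm)
  choose hdeg s hs hc using h
  exact ⟨hvars, hsize.mono hdeg, s, ((hsize.mul ((((PolyBounded.const 4).mul hvars).add
    (.const 1)).add (.const 1))).add (.const 1)).mono hs, hc⟩

theorem NClosure_mono {𝒞 𝒟 : Set (Family F)} (h : 𝒞 ⊆ 𝒟) : NClosure 𝒞 ⊆ NClosure 𝒟 :=
  fun _ ⟨g, hg, hf⟩ => ⟨g, h hg, hf⟩

theorem hasPolyManyVars_of_mem_VNP {f : Family F} (hf : f ∈ VNP F) : HasPolyManyVars f := by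
  obtain ⟨g, hg, p, q, _, hq, hf⟩ := hf
  exact (hg.1.comp hq).mono fun n => by
    rw [hf]
    exact card_vars_hypercubeSum_le _ _

theorem exists_affine_prod_of_mem_VNP (h2 : (2 : F) ≠ 0) {f : Family F} (hf : f ∈ VNP F) :
    ∃ (p m : ℕ → ℕ) (l : (n : ℕ) → Fin (m n) → MvPolynomial ℕ F),
      PolyBounded p ∧ PolyBounded m ∧ (∀ n i, IsAffineForm (l n i)) ∧
      ∀ n, f n = hypercubeSum (p n) (∏ i, l n i) := by
  obtain ⟨g, ⟨_, hdeg, s, hs, hc⟩, p, q, hp, hq, hf⟩ := hf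
  have h (n : ℕ) := (((hc (q n)).cubeRep h2 le_rfl).hypercubeSum (p n)).exists_hypercubeSum
  choose p' m l hcost hl h using h
  have hbound := hp.add ((hs.comp hq).circuitCost (hdeg.comp hq))
  refine ⟨p', m, l, hbound.mono fun n => ?_, hbound.mono fun n => ?_, hl, fun n => ?_⟩
  · exact (Nat.le_add_right _ _).trans (hcost n)
  · exact (Nat.le_add_left _ _).trans (hcost n)
  · rw [hf, h]

/-- The affine forms may contain variables that cancel in the sum, and superpolynomially many of
them; these are set to zero. -/
theorem mem_VNPk_one_of_affine_prod {f : Family F} (hvars : HasPolyManyVars f) {p m : ℕ → ℕ}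
    {l : (n : ℕ) → Fin (m n) → MvPolynomial ℕ F} (hp : PolyBounded p) (hm : PolyBounded m)
    (hl : ∀ n i, IsAffineForm (l n i)) (hf : ∀ n, f n = hypercubeSum (p n) (∏ i, l n i)) :
    f ∈ VNPk F 1 := by
  let S (n : ℕ) : Finset ℕ := Finset.range (p n) ∪ (f n).vars.image (· + p n)
  have hS (n : ℕ) : (S n).card ≤ p n + (f n).vars.card :=
    (Finset.card_union_le _ _).trans (add_le_add (by simp) Finset.card_image_le)
  have hl' (n i) := isAffineForm_restrictVars (S n) (hl n i)
  refine ⟨fun n => ∏ i, restrictVars (S n) (l n i), ⟨?_, fun n => ABP.ofProd _ (hl' n),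
    hm.add (.const 1), fun n => ⟨ABP.width_ofProd _ _, ABP.value_ofProd _ _⟩⟩, p, id, hp,
    ⟨Polynomial.X, by simp⟩, fun n => ?_⟩
  · refine (hp.add hvars).mono fun n => (Finset.card_le_card ?_).trans (hS n)
    dsimp only
    rw [← map_prod]
    exact vars_restrictVars_subset _ _
  · dsimp only [id]
    rw [← map_prod, ← restrictVars_hypercubeSum, ← hf, restrictVars_eq_self]

end AlgComplexity

theorem theorem4p3 (F : Type*) [Field F] (hF : ringChar F ≠ 2) :
    AlgComplexity.VNPk F 1 = AlgComplexity.VNP F ∧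
    ∀ f : AlgComplexity.Family F,
      f ∈ AlgComplexity.VNP F ↔
        AlgComplexity.HasPolyManyVars f ∧
        ∃ (p m : ℕ → ℕ) (l : (n : ℕ) → Fin (m n) → MvPolynomial ℕ F),
          AlgComplexity.PolyBounded p ∧ AlgComplexity.PolyBounded m ∧
          (∀ n i, AlgComplexity.IsAffineForm (l n i)) ∧
          ∀ n, f n = AlgComplexity.hypercubeSum (p n) (∏ i, l n i) := by
  open AlgComplexity in
  have h2 : (2 : F) ≠ 0 := Ring.two_ne_zero hF
  have hsub : VNPk F 1 ⊆ VNP F := NClosure_mono VPk_one_subset_VP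
  have hmem (f : Family F) (hf : f ∈ VNP F) :=
    And.intro (hasPolyManyVars_of_mem_VNP hf) (exists_affine_prod_of_mem_VNP h2 hf)
  refine ⟨hsub.antisymm fun f hf => ?_, fun f => ⟨hmem f, ?_⟩⟩
  · obtain ⟨hvars, p, m, l, hp, hm, hl, h⟩ := hmem f hf
    exact mem_VNPk_one_of_affine_prod hvars hp hm hl h
  · rintro ⟨hvars, p, m, l, hp, hm, hl, h⟩
    exact hsub (mem_VNPk_one_of_affine_prod hvars hp hm hl h)
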